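/- Conventions. Let $p$ be a prime and $R$ a Noetherian commutative ring of characteristic $p$. Let $R^{\circ}$ be the set of elements of $R$ that lie in no minimal prime ideal. For $e\ge 0$ let ${}^eR$ be the ring $R$ viewed as an $R$-algebra via the iterated Frobenius $F^e\colon x\mapsto x^{p^e}$; $R$ is F-finite if ${}^1R$ is a finitely generated $R$-module. For an $R$-module $M$ and $z\in M$, put $q=p^e$ and let $z^q$ be the image $z\otimes 1$ of $z$ in $M\otimes_R{}^eR$, regarded as an $R$-module through the right factor. For ideals $\mathfrak a_1,\dots,\mathfrak a_r\subseteq R$ and real numbers $t_1,\dots,t_r\ge 0$, let $0_M^{*\mathfrak a_1^{t_1}\cdots\mathfrak a_r^{t_r}}$ be the submodule of all $z\in M$ for which there is $c\in R^{\circ}$ with $$c\,z^q\,\mathfrak a_1^{\lceil t_1q\rceil}\cdots\mathfrak a_r^{\lceil t_rq\rceil}=0\quad\text{in } M\otimes_R{}^eR\quad\text{for all large } q=p^e$$ (where $\mathfrak a_i^{0}=R$). Let $E=\bigoplus_{\mathfrak m}E_R(R/\mathfrak m)$ be the direct sum, over all maximal ideals $\mathfrak m$ of $R$, of the injective hulls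 of the residue fields, and put $$\widetilde\tau(\mathfrak a_1^{t_1}\cdots\mathfrak a_r^{t_r})=\operatorname{Ann}_R\bigl(0_E^{*\mathfrak a_1^{t_1}\cdots\mathfrak a_r^{t_r}}\bigr).$$ Theorem. Let $R$ be an F-finite reduced Noetherian ring of prime characteristic $p>0$, and let $\mathfrak a,\mathfrak b\subseteq R$ be ideals such that $\mathfrak a\cap R^{\circ}\neq\emptyset$ and $\mathfrak b\cap R^{\circ}\neq\emptyset$. Then for every real number $t>0$, $$\widetilde\tau\bigl((\mathfrak a+\mathfrak b)^t\bigr)=\sum_{\substack{\lambda,\mu\ge 0\\ \lambda+\mu=t}}\widetilde\tau\bigl(\mathfrak a^{\lambda}\mathfrak b^{\mu}\bigr),$$ where $\lambda,\mu$ range over all non-negative real numbers with $\lambda+\mu=t$. -/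

import Mathlib

open scoped TensorProduct DirectSum

universe u

noncomputable section

/-! ### Injective hulls -/

/-- `i : M → E` is an injective hull of `M`: an essential embedding into an injective module. -/
structure IsInjectiveHull (R : Type u) [CommRing R] {M E : Type u} [AddCommGroup M] [Module R M]
    [AddCommGroup E] [Module R E] (i : M →ₗ[R] E) : Prop where
  injective_map : Function.Injective i
  essential : ∀ K : Submodule R E, K ⊓ LinearMap.range i = ⊥ → K = ⊥
  injective_module : Module.Injective R E

theorem exists_isInjectiveHull (R : Type u) [CommRing R] (M : Type u) [AddCommGroup M]
    [Module R M] :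
    ∃ E : ModuleCat.{u} R, ∃ i : M →ₗ[R] E, IsInjectiveHull R i := by
  obtain ⟨⟨I, hI, f, hf⟩⟩ :=
    (ModuleCat.enoughInjectives.{u, u} (R := R)).presentation (ModuleCat.of R M)
  have hfi : Function.Injective f.hom := (ModuleCat.mono_iff_injective f).1 hf
  have hInj : Module.Injective R I :=
    (Module.injective_iff_injective_object R I).2 hI
  set A : Submodule R I := LinearMap.range f.hom with hA
  -- a maximal essential extension of `A` inside `I`
  obtain ⟨N, hAN, hN⟩ := zorn_le_nonempty₀
    {N : Submodule R I | A ≤ N ∧ ∀ K : Submodule R I, K ≤ N → K ⊓ A = ⊥ → K = ⊥}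
    (by
      intro c hc hchain y hy
      refine ⟨sSup c, ⟨(hc hy).1.trans (le_sSup hy), ?_⟩, fun z hz => le_sSup hz⟩
      intro K hK hKA
      rw [Submodule.eq_bot_iff]
      intro x hx
      obtain ⟨N, hNc, hxN⟩ :=
        (Submodule.mem_sSup_of_directed ⟨y, hy⟩ hchain.directedOn).1 (hK hx)
      have h1 : Submodule.span R {x} = ⊥ := by
        refine (hc hNc).2 _ ((Submodule.span_singleton_le_iff_mem _ _).2 hxN) ?_
        refine le_bot_iff.1 (le_trans (inf_le_inf_right A ?_) hKA.le)
        exact (Submodule.span_singleton_le_iff_mem _ _).2 hx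
      exact Submodule.span_singleton_eq_bot.1 h1)
    A ⟨le_rfl, fun K hK hKA => by rwa [inf_eq_left.2 hK] at hKA⟩
  -- a maximal submodule disjoint from `N`
  obtain ⟨K, -, hK⟩ := zorn_le_nonempty₀ {K : Submodule R I | K ⊓ N = ⊥}
    (by
      intro c hc hchain y hy
      refine ⟨sSup c, ?_, fun z hz => le_sSup hz⟩
      change sSup c ⊓ N = ⊥
      rw [Submodule.eq_bot_iff]
      rintro x ⟨hx, hxN⟩
      obtain ⟨L, hLc, hxL⟩ := (Submodule.mem_sSup_of_directed ⟨y, hy⟩ hchain.directedOn).1 hx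
      have h1 : L ⊓ N = ⊥ := hc hLc
      exact (Submodule.eq_bot_iff _).1 h1 x ⟨hxL, hxN⟩)
    ⊥ (by simp)
  have hKN : K ⊓ N = ⊥ := hK.prop
  let j : N →ₗ[R] (I ⧸ K) := K.mkQ ∘ₗ N.subtype
  have hj : Function.Injective j := by
    rw [← LinearMap.ker_eq_bot, Submodule.eq_bot_iff]
    intro n hn
    have h1 : (n : I) ∈ K := (Submodule.Quotient.mk_eq_zero K).1 hn
    exact Subtype.ext ((Submodule.eq_bot_iff _).1 hKN n ⟨h1, n.2⟩)
  have hess : ∀ L : Submodule R (I ⧸ K), L ⊓ LinearMap.range j = ⊥ → L = ⊥ := by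
    intro L hL
    have hKL : K ≤ L.comap K.mkQ := by
      intro x hx
      have h0 : K.mkQ x = 0 := (Submodule.Quotient.mk_eq_zero K).2 hx
      rw [Submodule.mem_comap, h0]
      exact L.zero_mem
    have h1 : L.comap K.mkQ ⊓ N = ⊥ := by
      rw [Submodule.eq_bot_iff]
      rintro x ⟨hxL, hxN⟩
      have h2 : K.mkQ x = 0 := (Submodule.eq_bot_iff _).1 hL _ ⟨hxL, ⟨⟨x, hxN⟩, rfl⟩⟩
      exact (Submodule.eq_bot_iff _).1 hKN x ⟨(Submodule.Quotient.mk_eq_zero K).1 h2, hxN⟩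
    have h3 : L.comap K.mkQ ≤ K := hK.le_of_ge h1 hKL
    rw [Submodule.eq_bot_iff]
    intro x hx
    obtain ⟨x, rfl⟩ := K.mkQ_surjective x
    exact (Submodule.Quotient.mk_eq_zero K).2 (h3 hx)
  obtain ⟨g, hg⟩ := hInj.out j hj N.subtype
  have hgker : LinearMap.ker g = ⊥ := by
    apply hess
    rw [Submodule.eq_bot_iff]
    rintro _ ⟨hx, ⟨n, rfl⟩⟩
    have h1 : (n : I) = 0 := by
      have h2 := hg n
      rw [LinearMap.mem_ker.1 hx] at h2
      exact h2.symm
    rw [show n = 0 from Subtype.ext h1, map_zero]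
  have hNg : N ≤ LinearMap.range g := fun n hn => ⟨j ⟨n, hn⟩, hg ⟨n, hn⟩⟩
  have hgN : LinearMap.range g ≤ N := by
    refine hN.le_of_ge ⟨hAN.trans hNg, ?_⟩ hNg
    intro T hT hTA
    have hTN : T ⊓ N = ⊥ := by
      apply hN.prop.2 _ inf_le_right
      exact le_bot_iff.1 (le_trans (inf_le_inf_right A inf_le_left) hTA.le)
    have h1 : T.comap g = ⊥ := by
      apply hess
      rw [Submodule.eq_bot_iff]
      rintro _ ⟨hx, ⟨n, rfl⟩⟩
      have h2 : g (j n) = n := hg n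
      have h3 : (n : I) ∈ T := h2 ▸ hx
      have h4 : (n : I) = 0 := (Submodule.eq_bot_iff _).1 hTN _ ⟨h3, n.2⟩
      rw [show n = 0 from Subtype.ext h4, map_zero]
    rw [Submodule.eq_bot_iff]
    intro x hx
    obtain ⟨y, rfl⟩ := hT hx
    rw [(Submodule.eq_bot_iff _).1 h1 y hx, map_zero]
  let π : I →ₗ[R] N := (g ∘ₗ K.mkQ).codRestrict N (fun x => hgN ⟨_, rfl⟩)
  have hπ : ∀ n : N, π n = n := fun n => Subtype.ext (hg n)
  refine ⟨ModuleCat.of R N, f.hom.codRestrict N (fun x => hAN ⟨x, rfl⟩), ?_, ?_, ?_⟩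
  · intro x y hxy
    exact hfi (congrArg Subtype.val hxy)
  · intro L hL
    have h1 : L.map N.subtype = ⊥ := by
      apply hN.prop.2 _ (Submodule.map_subtype_le N L)
      rw [Submodule.eq_bot_iff]
      rintro _ ⟨⟨n, hn, rfl⟩, ⟨m, hm⟩⟩
      have h2 : n = 0 := (Submodule.eq_bot_iff _).1 hL n ⟨hn, ⟨m, Subtype.ext hm⟩⟩
      rw [h2, map_zero]
    rw [Submodule.eq_bot_iff]
    intro n hn
    exact Subtype.ext ((Submodule.eq_bot_iff _).1 h1 n ⟨n, hn, rfl⟩)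
  · refine ⟨fun X Y _ _ _ _ a ha b => ?_⟩
    obtain ⟨h, hh⟩ := hInj.out a ha (N.subtype ∘ₗ b)
    exact ⟨π ∘ₗ h, fun x => by
      rw [LinearMap.comp_apply, hh x]
      exact hπ (b x)⟩

/-- The injective hull `E_R(M)` of an `R`-module `M`. -/
def InjectiveHull (R : Type u) [CommRing R] (M : Type u) [AddCommGroup M] [Module R M] : Type u :=
  (exists_isInjectiveHull R M).choose

instance (R : Type u) [CommRing R] (M : Type u) [AddCommGroup M] [Module R M] :
    AddCommGroup (InjectiveHull R M) :=
  inferInstanceAs (AddCommGroup (exists_isInjectiveHull R M).choose)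

instance (R : Type u) [CommRing R] (M : Type u) [AddCommGroup M] [Module R M] :
    Module R (InjectiveHull R M) :=
  inferInstanceAs (Module R (exists_isInjectiveHull R M).choose)

/-- The embedding `M → E_R(M)`. -/
def InjectiveHull.ι (R : Type u) [CommRing R] (M : Type u) [AddCommGroup M] [Module R M] :
    M →ₗ[R] InjectiveHull R M :=
  (exists_isInjectiveHull R M).choose_spec.choose

theorem InjectiveHull.isInjectiveHull (R : Type u) [CommRing R] (M : Type u) [AddCommGroup M]
    [Module R M] : IsInjectiveHull R (InjectiveHull.ι R M) :=
  (exists_isInjectiveHull R M).choose_spec.choose_spec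

/-- `E = ⨁ E_R(R/m)`, the direct sum over all maximal ideals `m` of `R`. -/
abbrev ResidueHull (R : Type u) [CommRing R] : Type u :=
  ⨁ m : MaximalSpectrum R, InjectiveHull R (R ⧸ m.asIdeal)

/-! ### Frobenius -/

/-- `R` is F-finite: `R` is a finite module over itself via the Frobenius map `x ↦ x ^ p`. -/
def IsFFinite (R : Type u) [CommRing R] (p : ℕ) [Fact p.Prime] [CharP R p] : Prop :=
  (frobenius R p).Finite

/-- The ring `ᵉR`: a copy of `R`, which is made an `R`-algebra through the `e`-fold iterated
Frobenius map `R → R`, `x ↦ x ^ (p ^ e)`. -/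
def FrobTwist (R : Type u) [CommRing R] (_p _e : ℕ) : Type u := R

instance (R : Type u) [CommRing R] (p e : ℕ) : CommRing (FrobTwist R p e) :=
  inferInstanceAs (CommRing R)

/-- The identity `R → ᵉR` on underlying rings (it is not `R`-linear). -/
def toFrobTwist (R : Type u) [CommRing R] (p e : ℕ) : R ≃+* FrobTwist R p e := RingEquiv.refl R

instance (R : Type u) [CommRing R] (p e : ℕ) [Fact p.Prime] [CharP R p] :
    Algebra R (FrobTwist R p e) :=
  ((toFrobTwist R p e).toRingHom.comp (iterateFrobenius R p e)).toAlgebra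

theorem algebraMap_frobTwist (R : Type u) [CommRing R] (p e : ℕ) [Fact p.Prime] [CharP R p]
    (x : R) : algebraMap R (FrobTwist R p e) x = toFrobTwist R p e (x ^ p ^ e) := rfl

/-- The Frobenius functor `𝔽ᵉ(M) = ᵉR ⊗ M`, a module over the ring `ᵉR` (which is `R`). -/
abbrev FrobModule (R : Type u) [CommRing R] (p e : ℕ) [Fact p.Prime] [CharP R p]
    (M : Type u) [AddCommGroup M] [Module R M] : Type u :=
  FrobTwist R p e ⊗[R] M

/-- The element `z ^ q = 1 ⊗ z` of `𝔽ᵉ(M)`, where `q = p ^ e`. -/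
def frobPow {R : Type u} [CommRing R] (p e : ℕ) [Fact p.Prime] [CharP R p]
    {M : Type u} [AddCommGroup M] [Module R M] (z : M) : FrobModule R p e M :=
  (1 : FrobTwist R p e) ⊗ₜ[R] z

/-- `N^[q]`, the image of `𝔽ᵉ(N) → 𝔽ᵉ(M)`. -/
def frobImage {R : Type u} [CommRing R] (p e : ℕ) [Fact p.Prime] [CharP R p]
    {M : Type u} [AddCommGroup M] [Module R M] (N : Submodule R M) :
    Submodule (FrobTwist R p e) (FrobModule R p e M) :=
  LinearMap.range (N.subtype.baseChange (FrobTwist R p e))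

/-! ### Tight closure with real exponents and the ideal `τ̃` -/

/-- `R°`, the elements of `R` that lie in no minimal prime ideal. -/
def ringCirc (R : Type u) [CommRing R] : Submonoid R where
  carrier := {c | ∀ P ∈ minimalPrimes R, c ∉ P}
  one_mem' P hP h := hP.1.1.ne_top ((Ideal.eq_top_iff_one P).2 h)
  mul_mem' ha hb P hP h := (hP.1.1.mem_or_mem h).elim (ha P hP) (hb P hP)

/-- The ideal `𝔞₁ ^ ⌈t₁ q⌉ ⋯ 𝔞ᵣ ^ ⌈tᵣ q⌉`, where `q = p ^ e`. -/
def ceilPow {R : Type u} [CommRing R] (p : ℕ) {r : ℕ} (𝔞 : Fin r → Ideal R) (t : Fin r → ℝ)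
    (e : ℕ) : Ideal R :=
  ∏ i, 𝔞 i ^ ⌈t i * (p : ℝ) ^ e⌉₊

/-- The `𝔞₁ ^ t₁ ⋯ 𝔞ᵣ ^ tᵣ`-tight closure of a submodule `N` of `M` (for exponents `tᵢ ≥ 0`): all
`z` for which there is `c ∈ R°` with `c z ^ q 𝔞₁ ^ ⌈t₁ q⌉ ⋯ 𝔞ᵣ ^ ⌈tᵣ q⌉ ⊆ N^[q]` for all
large `q = p ^ e`. -/
def tightClosure {R : Type u} [CommRing R] (p : ℕ) [Fact p.Prime] [CharP R p]
    {r : ℕ} (𝔞 : Fin r → Ideal R) (t : Fin r → ℝ)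
    {M : Type u} [AddCommGroup M] [Module R M] (N : Submodule R M) : Submodule R M where
  carrier := {z | ∃ c ∈ ringCirc R, ∃ e₀ : ℕ, ∀ e ≥ e₀, ∀ x ∈ ceilPow p 𝔞 t e,
    toFrobTwist R p e (c * x) • frobPow p e z ∈ frobImage p e N}
  zero_mem' := ⟨1, one_mem _, 0, fun e _ x _ => by simp [frobPow]⟩
  add_mem' := by
    rintro y z ⟨c, hc, e₁, h₁⟩ ⟨d, hd, e₂, h₂⟩
    refine ⟨c * d, mul_mem hc hd, max e₁ e₂, fun e he x hx => ?_⟩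
    have hy := h₁ e (le_of_max_le_left he) x hx
    have hz := h₂ e (le_of_max_le_right he) x hx
    have e1 : toFrobTwist R p e (c * d * x) =
        toFrobTwist R p e d * toFrobTwist R p e (c * x) := by
      rw [← map_mul]; congr 1; ring
    have e2 : toFrobTwist R p e (c * d * x) =
        toFrobTwist R p e c * toFrobTwist R p e (d * x) := by
      rw [← map_mul]; congr 1; ring
    have e3 : frobPow p e (y + z) = frobPow (R := R) p e y + frobPow p e z :=
      TensorProduct.tmul_add _ _ _
    rw [e3, smul_add]
    refine add_mem ?_ ?_
    · rw [e1, mul_smul]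
      exact Submodule.smul_mem _ _ hy
    · rw [e2, mul_smul]
      exact Submodule.smul_mem _ _ hz
  smul_mem' := by
    rintro a z ⟨c, hc, e₀, h⟩
    refine ⟨c, hc, e₀, fun e he x hx => ?_⟩
    have e1 : frobPow p e (a • z) =
        algebraMap R (FrobTwist R p e) a • frobPow (R := R) p e z := by
      rw [algebraMap_smul]
      exact TensorProduct.tmul_smul _ _ _
    rw [e1, smul_comm]
    exact Submodule.smul_mem _ _ (h e he x hx)

/-- The ideal `τ̃(𝔞₁ ^ t₁ ⋯ 𝔞ᵣ ^ tᵣ)`: the annihilator of the `𝔞₁ ^ t₁ ⋯ 𝔞ᵣ ^ tᵣ`-tight closure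
of zero in `E = ⨁ E_R(R/m)`. -/
def tauTilde {R : Type u} [CommRing R] (p : ℕ) [Fact p.Prime] [CharP R p]
    {r : ℕ} (𝔞 : Fin r → Ideal R) (t : Fin r → ℝ) : Ideal R :=
  (tightClosure p 𝔞 t (⊥ : Submodule R (ResidueHull R))).annihilator

end

/-! Write q = p^e. The inclusion ⊇ is subadditivity of the ceiling: `𝔞 ^ ⌈λq⌉ * 𝔟 ^ ⌈μq⌉` lies in
`(𝔞 + 𝔟) ^ ⌈tq⌉`, and smaller ideals give larger closures.

For ⊆, let S be the sum on the right. Since E is a cogenerator (`exists_residueHull_smul_ne_zero`),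
it suffices that every z in E killed by S lies in the `(𝔞 + 𝔟) ^ t`-tight closure of zero. Duality
(`tmul_residueHull_eq_zero`) turns the vanishing of Dy ⊗ z into ψ(Dy)z = 0 for all p⁻ᵉ-linear ψ, so
one needs ψ(Dy) ∈ S for y in `(𝔞 + 𝔟) ^ ⌈tq⌉`. That power is the sum of the `𝔞 ^ i * 𝔟 ^ j` with i +
j = ⌈tq⌉, and each such (i, j) is (⌈λq⌉, ⌈μq⌉) for some λ + μ = t (`exists_add_eq_and_ceil_eq`);
then `IsCartierMap.apply_mem_tauTilde` applies.

As λ and μ vary with e, a single multiplier D must serve all exponents. It is a test element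
(`IsFFinite.exists_test_element`), obtained from generic projectivity of F_*R and Krull's
intersection theorem. -/

noncomputable section

/-! ### p⁻ᵉ-linear maps -/

variable {R : Type u} [CommRing R] {p : ℕ}

/-- A `p⁻ᵉ`-linear map of `R`: an additive map `ψ` with `ψ (r ^ q * x) = r * ψ x`, where
`q = p ^ e`. -/
def IsCartierMap (p e : ℕ) (ψ : R →+ R) : Prop :=
  ∀ r x : R, ψ (r ^ p ^ e * x) = r * ψ x

namespace IsCartierMap

theorem comp {e e' : ℕ} {φ θ : R →+ R} (hφ : IsCartierMap p e φ) (hθ : IsCartierMap p e' θ) :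
    IsCartierMap p (e + e') (φ.comp θ) := by
  intro r x
  rw [AddMonoidHom.comp_apply, AddMonoidHom.comp_apply, pow_add, pow_mul, hθ, hφ]

theorem comp_mulLeft {e : ℕ} {φ : R →+ R} (hφ : IsCartierMap p e φ) (a : R) :
    IsCartierMap p e (φ.comp (AddMonoidHom.mulLeft a)) := by
  intro r x
  simp only [AddMonoidHom.comp_apply, AddMonoidHom.coe_mulLeft]
  rw [mul_left_comm, hφ]

theorem mulLeft_comp {e : ℕ} {φ : R →+ R} (hφ : IsCartierMap p e φ) (a : R) :
    IsCartierMap p e ((AddMonoidHom.mulLeft a).comp φ) := by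
  intro r x
  simp only [AddMonoidHom.comp_apply, AddMonoidHom.coe_mulLeft]
  rw [hφ, mul_left_comm]

theorem add {e : ℕ} {φ ψ : R →+ R} (hφ : IsCartierMap p e φ) (hψ : IsCartierMap p e ψ) :
    IsCartierMap p e (φ + ψ) := by
  intro r x
  rw [AddMonoidHom.add_apply, AddMonoidHom.add_apply, hφ, hψ, mul_add]

theorem zero (e : ℕ) : IsCartierMap p e (0 : R →+ R) := by
  intro r x; simp

theorem id : IsCartierMap p 0 (AddMonoidHom.id R) := by
  intro r x; simp

end IsCartierMap

/-- The ideal of all values `ψ c`, for `ψ` a `p⁻ᵉ`-linear map of `R`. -/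
def cartierIdeal (p e : ℕ) (c : R) : Ideal R where
  carrier := {x | ∃ ψ : R →+ R, IsCartierMap p e ψ ∧ ψ c = x}
  zero_mem' := ⟨0, IsCartierMap.zero e, rfl⟩
  add_mem' := by
    rintro _ _ ⟨φ, hφ, rfl⟩ ⟨ψ, hψ, rfl⟩
    exact ⟨φ + ψ, hφ.add hψ, rfl⟩
  smul_mem' := by
    rintro a _ ⟨φ, hφ, rfl⟩
    exact ⟨_, hφ.mulLeft_comp a, rfl⟩

section FrobTwist

variable [Fact p.Prime] [CharP R p]

/-- A `p⁻ᵉ`-linear map of `R`, as an `R`-linear map `ᵉR → R`. -/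
def IsCartierMap.toLinearMap {e : ℕ} {ψ : R →+ R} (hψ : IsCartierMap p e ψ) :
    FrobTwist R p e →ₗ[R] R where
  toFun x := ψ ((toFrobTwist R p e).symm x)
  map_add' x y := by rw [map_add, map_add]
  map_smul' r x := by
    rw [Algebra.smul_def, algebraMap_frobTwist, map_mul, RingEquiv.symm_apply_apply, hψ]
    rfl

theorem isCartierMap_of_linearMap {e : ℕ} (φ : FrobTwist R p e →ₗ[R] R) :
    IsCartierMap p e (φ.toAddMonoidHom.comp (toFrobTwist R p e).toAddMonoidHom) := by
  intro r x
  change φ (toFrobTwist R p e (r ^ p ^ e * x)) = r * φ (toFrobTwist R p e x)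
  rw [map_mul, ← algebraMap_frobTwist, ← Algebra.smul_def, map_smul, smul_eq_mul]

/-- Tensoring the linear map ᵉR → R given by ψ with M sends y ⊗ z to ψ(y)z. -/
theorem IsCartierMap.smul_eq_zero {e : ℕ} {ψ : R →+ R} (hψ : IsCartierMap p e ψ)
    {M : Type u} [AddCommGroup M] [Module R M] {y : R} {z : M}
    (h : toFrobTwist R p e y ⊗ₜ[R] z = (0 : FrobModule R p e M)) : ψ y • z = 0 := by
  have := congrArg (TensorProduct.lid R M ∘ hψ.toLinearMap.rTensor M) h
  simpa [IsCartierMap.toLinearMap] using this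

theorem IsFFinite.finite_frobTwist (hF : IsFFinite R p) (e : ℕ) :
    Module.Finite R (FrobTwist R p e) := by
  have h : (iterateFrobenius R p e).Finite := by
    induction e with
    | zero =>
      rw [iterateFrobenius_zero]
      exact RingHom.Finite.id R
    | succ e ih =>
      rw [iterateFrobenius_add, iterateFrobenius_one]
      exact ih.comp hF
  have h2 : (algebraMap R (FrobTwist R p e)).Finite :=
    RingHom.Finite.comp (RingHom.Finite.of_surjective _ (toFrobTwist R p e).surjective) h
  exact h2

theorem frobImage_bot {M : Type u} [AddCommGroup M] [Module R M] (e : ℕ) :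
    frobImage p e (⊥ : Submodule R M) = ⊥ := by
  rw [frobImage, LinearMap.range_eq_bot]
  have : (⊥ : Submodule R M).subtype = 0 := by
    ext x; exact (Submodule.mem_bot R).1 x.2
  rw [this, LinearMap.baseChange_zero]

theorem smul_frobPow {M : Type u} [AddCommGroup M] [Module R M] (e : ℕ) (x : R) (z : M) :
    toFrobTwist R p e x • frobPow p e z = toFrobTwist R p e x ⊗ₜ[R] z := by
  rw [frobPow, TensorProduct.smul_tmul', smul_eq_mul, mul_one]

theorem mem_tightClosure_bot {r : ℕ} {𝔞 : Fin r → Ideal R} {t : Fin r → ℝ}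
    {M : Type u} [AddCommGroup M] [Module R M] {z : M} :
    z ∈ tightClosure p 𝔞 t (⊥ : Submodule R M) ↔ ∃ c ∈ ringCirc R, ∃ e₀ : ℕ, ∀ e ≥ e₀,
      ∀ x ∈ ceilPow p 𝔞 t e,
        toFrobTwist R p e (c * x) ⊗ₜ[R] z = (0 : FrobModule R p e M) := by
  change (∃ c ∈ ringCirc R, ∃ e₀ : ℕ, ∀ e ≥ e₀, ∀ x ∈ ceilPow p 𝔞 t e,
    toFrobTwist R p e (c * x) • frobPow p e z ∈ frobImage p e ⊥) ↔ _
  simp only [frobImage_bot, smul_frobPow, Submodule.mem_bot]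

end FrobTwist

/-! ### Duality with injective hulls -/

/-- If `E` is injective, `S` is finitely generated and `R` is Noetherian, then the canonical map
`S ⊗ E → Hom (Hom (S, R), E)` has no pure tensors in its kernel. -/
theorem tmul_eq_zero_of_forall_dual [IsNoetherianRing R] {S E : Type u} [AddCommGroup S]
    [Module R S] [Module.Finite R S] [AddCommGroup E] [Module R E] (hE : Module.Injective R E)
    {y : S} {z : E} (h : ∀ φ : S →ₗ[R] R, φ y • z = 0) : y ⊗ₜ[R] z = 0 := by
  obtain ⟨n, π, hπ⟩ := Module.Finite.exists_fin' R S
  obtain ⟨m, A, hA⟩ := Module.Finite.exists_fin' R (LinearMap.ker π)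
  obtain ⟨v, rfl⟩ := hπ y
  let B : (Fin m → R) →ₗ[R] (Fin n → R) := (LinearMap.ker π).subtype ∘ₗ A
  have hπB : ∀ x, π (B x) = 0 := fun x => (A x).2
  let α : ((Fin n → R) →ₗ[R] R) →ₗ[R] ((Fin m → R) →ₗ[R] R) := LinearMap.lcomp R R B
  let g : ((Fin n → R) →ₗ[R] R) →ₗ[R] E :=
    (LinearMap.toSpanSingleton R E z) ∘ₗ (LinearMap.applyₗ v)
  have hg : ∀ f, g f = f v • z := fun f => rfl
  -- For the presentation R^m → R^n → S, the kernel of α is the dual of S, where the hypothesis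
  -- makes g vanish. So g factors through the image of α and extends, by injectivity of E, to k.
  have hker : LinearMap.ker α ≤ LinearMap.ker g := by
    intro f hf
    have hf0 : ∀ x ∈ LinearMap.ker π, f x = 0 := by
      intro x hx
      obtain ⟨w, hw⟩ := hA ⟨x, hx⟩
      have h1 : f (B w) = 0 := LinearMap.congr_fun (LinearMap.mem_ker.1 hf) w
      have h2 : B w = x := congrArg Subtype.val hw
      rwa [h2] at h1
    let φ : S →ₗ[R] R :=
      (LinearMap.ker π).liftQ f hf0 ∘ₗ (π.quotKerEquivOfSurjective hπ).symm.toLinearMap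
    have hφ : φ (π v) = f v := by
      have : (π.quotKerEquivOfSurjective hπ).symm (π v) = (LinearMap.ker π).mkQ v := by
        rw [LinearEquiv.symm_apply_eq]; rfl
      change (LinearMap.ker π).liftQ f hf0 ((π.quotKerEquivOfSurjective hπ).symm (π v)) = f v
      rw [this]
      rfl
    rw [LinearMap.mem_ker, hg, ← hφ]
    exact h φ
  obtain ⟨k, hk⟩ := hE.out ((LinearMap.ker α).liftQ α le_rfl)
    (by rw [← LinearMap.ker_eq_bot]; exact Submodule.ker_liftQ_eq_bot _ _ _ le_rfl)
    ((LinearMap.ker α).liftQ g hker)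
  have hk' : ∀ f, k (α f) = f v • z := fun f => hk ((LinearMap.ker α).mkQ f)
  -- Evaluating k on coordinate functions writes the coordinates of v, times z, through the
  -- relations B, which die in S.
  have hcoord : ∀ i, v i • z = ∑ j, B (Pi.single j 1) i • k (LinearMap.proj j) := by
    intro i
    have h1 : α (LinearMap.proj i) = ∑ j, B (Pi.single j 1) i • LinearMap.proj j := by
      refine LinearMap.pi_ext' fun j => LinearMap.ext_ring ?_
      simp [α, Pi.single_apply]
    have := hk' (LinearMap.proj i)
    rw [h1, map_sum] at this
    simpa using this.symm
  have hv : ∀ w, π w = ∑ i, w i • π (Pi.single i 1) := by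
    intro w
    conv_lhs => rw [pi_eq_sum_univ' w]
    simp [map_sum]
  rw [hv v, TensorProduct.sum_tmul]
  simp_rw [TensorProduct.smul_tmul, hcoord, TensorProduct.tmul_sum]
  rw [Finset.sum_comm]
  refine Finset.sum_eq_zero fun j _ => ?_
  simp_rw [← TensorProduct.smul_tmul, ← TensorProduct.sum_tmul]
  have h2 : ∑ i, B (Pi.single j 1) i • π (Pi.single i 1) = 0 := by
    rw [← hv, hπB]
  rw [h2, TensorProduct.zero_tmul]

/-- `E` is a cogenerator: an element outside an ideal `J` does not annihilate `Ann_E J`. -/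
theorem exists_residueHull_smul_ne_zero {J : Ideal R} {x : R} (hx : x ∉ J) :
    ∃ z : ResidueHull R, (∀ r ∈ J, r • z = 0) ∧ x • z ≠ 0 := by
  classical
  let f : R →ₗ[R] R ⧸ J := LinearMap.toSpanSingleton R (R ⧸ J) (Submodule.Quotient.mk x)
  have hf : LinearMap.ker f ≠ ⊤ := by
    intro h
    have : f 1 = 0 := LinearMap.mem_ker.1 (h ▸ Submodule.mem_top)
    rw [LinearMap.toSpanSingleton_apply, one_smul, Submodule.Quotient.mk_eq_zero] at this
    exact hx this
  obtain ⟨m, hm, hle⟩ := Ideal.exists_le_maximal (LinearMap.ker f) hf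
  have hull := InjectiveHull.isInjectiveHull R (R ⧸ m)
  have hker : LinearMap.ker f ≤ LinearMap.ker (InjectiveHull.ι R (R ⧸ m) ∘ₗ m.mkQ) := by
    intro r hr
    have : m.mkQ r = 0 := (Submodule.Quotient.mk_eq_zero m).2 (hle hr)
    rw [LinearMap.mem_ker, LinearMap.comp_apply, this, map_zero]
  -- The cyclic module generated by x in R/J maps onto R/m ⊆ E(R/m). Extend this to g on R/J; the
  -- image of 1 is the required element.
  obtain ⟨g, hg⟩ := hull.injective_module.out ((LinearMap.ker f).liftQ f le_rfl)
    (by rw [← LinearMap.ker_eq_bot]; exact Submodule.ker_liftQ_eq_bot _ _ _ le_rfl)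
    ((LinearMap.ker f).liftQ _ hker)
  have hg1 : g (Submodule.Quotient.mk x) = InjectiveHull.ι R (R ⧸ m) (m.mkQ 1) := by
    have h1 : g (f 1) = _ := hg ((LinearMap.ker f).mkQ 1)
    rw [LinearMap.toSpanSingleton_apply, one_smul] at h1
    exact h1
  have hmk : ∀ r : R, r • g (Submodule.Quotient.mk 1) = g (Submodule.Quotient.mk r) := by
    intro r
    rw [← map_smul, ← Submodule.Quotient.mk_smul, smul_eq_mul, mul_one]
  refine ⟨DirectSum.lof R (MaximalSpectrum R) (fun m => InjectiveHull R (R ⧸ m.asIdeal)) ⟨m, hm⟩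
    (g (Submodule.Quotient.mk 1)), fun r hr => ?_, fun h => ?_⟩
  · rw [← map_smul, hmk, (Submodule.Quotient.mk_eq_zero J).2 hr, map_zero, map_zero]
  · rw [← map_smul, hmk, hg1] at h
    have h2 := DirectSum.of_injective (β := fun m : MaximalSpectrum R =>
      InjectiveHull R (R ⧸ m.asIdeal)) ⟨m, hm⟩ (h.trans (map_zero _).symm)
    have h3 : m.mkQ 1 = 0 := hull.injective_map (h2.trans (map_zero _).symm)
    exact hm.ne_top ((Ideal.eq_top_iff_one m).2 ((Submodule.Quotient.mk_eq_zero m).1 h3))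

/-- For `E = ⨁ E_R(R/m)`, an element of `ᵉR ⊗ E` of the form `y ⊗ z` vanishes as soon as `z` is
annihilated by the values at `y` of all `p⁻ᵉ`-linear maps. -/
theorem tmul_residueHull_eq_zero [IsNoetherianRing R] [Fact p.Prime] [CharP R p]
    (hF : IsFFinite R p) {e : ℕ} {y : R} {z : ResidueHull R}
    (h : ∀ ψ : R →+ R, IsCartierMap p e ψ → ψ y • z = 0) :
    toFrobTwist R p e y ⊗ₜ[R] z = (0 : FrobModule R p e (ResidueHull R)) := by
  classical
  have := hF.finite_frobTwist e
  have hz : z = ∑ m ∈ z.support, DirectSum.lof R _ _ m (z m) := (DirectSum.sum_support_of z).symm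
  rw [hz, TensorProduct.tmul_sum]
  refine Finset.sum_eq_zero fun m _ => ?_
  have h0 : toFrobTwist R p e y ⊗ₜ[R] z m = 0 := by
    refine tmul_eq_zero_of_forall_dual
      (InjectiveHull.isInjectiveHull R (R ⧸ m.asIdeal)).injective_module fun φ => ?_
    have h1 := h _ (isCartierMap_of_linearMap φ)
    have h2 := congrArg (DirectSum.component R _ _ m) h1
    rw [map_smul, map_zero] at h2
    exact h2
  have := congrArg (LinearMap.lTensor (FrobTwist R p e)
    (DirectSum.lof R _ (fun m : MaximalSpectrum R => InjectiveHull R (R ⧸ m.asIdeal)) m)) h0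
  rwa [LinearMap.lTensor_tmul, map_zero] at this

/-! ### Generic projectivity of F_*R -/

/-- Prime avoidance for `R°`: an ideal contained in no minimal prime meets `R°`. -/
theorem exists_mem_ringCirc_of_forall_minimalPrimes [IsNoetherianRing R] {I : Ideal R}
    (h : ∀ P ∈ minimalPrimes R, ∃ x ∈ I, x ∉ P) : ∃ x ∈ I, x ∈ ringCirc R := by
  classical
  have hfin : (minimalPrimes R).Finite := minimalPrimes.finite_of_isNoetherianRing R
  by_contra! hI
  have hsub : (I : Set R) ⊆ ⋃ P ∈ (hfin.toFinset : Set (Ideal R)), P := by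
    intro x hx
    have := hI x hx
    change ¬ ∀ P ∈ minimalPrimes R, x ∉ P at this
    push Not at this
    obtain ⟨P, hP, hxP⟩ := this
    exact Set.mem_biUnion (by simpa using hP) hxP
  obtain ⟨P, hP, hle⟩ := (Ideal.subset_union_prime (f := fun P : Ideal R => P) ⊥ ⊥
    (fun P hP _ _ => ((hfin.mem_toFinset.1 hP).1.1 : P.IsPrime))).1 hsub
  obtain ⟨x, hx, hxP⟩ := h P (hfin.mem_toFinset.1 hP)
  exact hxP (hle hx)

theorem ringCirc_le_nonZeroDivisors [IsReduced R] : ringCirc R ≤ nonZeroDivisors R := by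
  intro c hc
  rw [mem_nonZeroDivisors_iff_right]
  intro x hx
  have h : x ∈ sInf (minimalPrimes R) := by
    rw [Submodule.mem_sInf]
    intro P hP
    have := hP.1.1
    exact (this.mem_or_mem (hx ▸ P.zero_mem : x * c ∈ P)).resolve_right (hc P hP)
  rw [minimalPrimes, Ideal.sInf_minimalPrimes] at h
  exact (mem_nilradical.1 h : IsNilpotent x).eq_zero

theorem isField_localization_of_mem_minimalPrimes [IsReduced R] (P : Ideal R) [P.IsPrime]
    (hP : P ∈ minimalPrimes R) : IsField (Localization.AtPrime P) := by
  rw [IsLocalRing.isField_iff_maximalIdeal_eq, ← Localization.AtPrime.map_eq_maximalIdeal,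
    ← IsLocalization.AtPrime.radical_map_of_mem_minimalPrimes (Localization.AtPrime P) P ⊥ hP,
    Ideal.map_bot]
  exact (nilradical_eq_zero _)

theorem IsField.projective {K : Type*} [CommRing K] (hK : IsField K) (M : Type*) [AddCommGroup M]
    [Module K M] : Module.Projective K M := by
  let := hK.toField
  infer_instance

/-- A finite module over a reduced Noetherian ring is projective at each minimal prime. -/
theorem exists_comp_eq_smul_id_of_mem_minimalPrimes [IsNoetherianRing R] [IsReduced R]
    {M N : Type u} [AddCommGroup M] [Module R M] [Module.Finite R M] [AddCommGroup N] [Module R N]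
    {π : N →ₗ[R] M} (hπ : Function.Surjective π) {P : Ideal R} (hP : P ∈ minimalPrimes R) :
    ∃ s ∉ P, ∃ h : M →ₗ[R] N, π ∘ₗ h = s • LinearMap.id := by
  have : P.IsPrime := hP.1.1
  have : Module.FinitePresentation R M := Module.finitePresentation_of_finite R M
  have hproj := (isField_localization_of_mem_minimalPrimes P hP).projective
    (LocalizedModule P.primeCompl M)
  let fN := LocalizedModule.mkLinearMap P.primeCompl N
  let fM := LocalizedModule.mkLinearMap P.primeCompl M
  have hπf : (LocalizedModule.map P.primeCompl π).restrictScalars R ∘ₗ fN = fM ∘ₗ π := by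
    ext x; simp [fN, fM, LocalizedModule.mkLinearMap_apply, LocalizedModule.map_mk]
  obtain ⟨σ, hσ⟩ := Module.projective_lifting_property (LocalizedModule.map P.primeCompl π)
    LinearMap.id (LocalizedModule.map_surjective P.primeCompl π hπ)
  obtain ⟨h, s, hs⟩ := Module.FinitePresentation.exists_lift_of_isLocalizedModule P.primeCompl fN
    (σ.restrictScalars R ∘ₗ fM)
  have h1 : fM ∘ₗ (π ∘ₗ h) = fM ∘ₗ (s • LinearMap.id) := by
    rw [← LinearMap.comp_assoc, ← hπf, LinearMap.comp_assoc, hs]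
    ext x
    have := LinearMap.congr_fun hσ (fM x)
    simp only [LinearMap.comp_apply, LinearMap.smul_apply, LinearMap.restrictScalars_apply,
      LinearMap.id_apply, Submonoid.smul_def, map_smul] at this ⊢
    rw [this]
  obtain ⟨s', hs'⟩ :=
    Module.Finite.exists_smul_of_comp_eq_of_isLocalizedModule P.primeCompl fM _ _ h1
  refine ⟨s' * s, (s' * s).2, (s' : R) • h, ?_⟩
  rw [LinearMap.comp_smul, mul_smul]
  exact hs'

/-- A finite module over a reduced Noetherian ring has a dual basis up to a factor in `R°`. -/
theorem exists_dual_sum_eq_smul [IsNoetherianRing R] [IsReduced R] (M : Type u) [AddCommGroup M]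
    [Module R M] [Module.Finite R M] :
    ∃ d ∈ ringCirc R, ∃ (n : ℕ) (φ : Fin n → M →ₗ[R] R) (u : Fin n → M),
      ∀ x, d • x = ∑ i, φ i x • u i := by
  obtain ⟨n, π, hπ⟩ := Module.Finite.exists_fin' R M
  let T : Ideal R :=
    { carrier := {d | ∃ h : M →ₗ[R] (Fin n → R), π ∘ₗ h = d • LinearMap.id}
      zero_mem' := ⟨0, by simp⟩
      add_mem' := by
        rintro a b ⟨g, hg⟩ ⟨h, hh⟩
        exact ⟨g + h, by rw [LinearMap.comp_add, hg, hh, add_smul]⟩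
      smul_mem' := by
        rintro a b ⟨g, hg⟩
        exact ⟨a • g, by rw [LinearMap.comp_smul, hg, smul_smul, smul_eq_mul]⟩ }
  obtain ⟨d, ⟨h, hh⟩, hd⟩ := exists_mem_ringCirc_of_forall_minimalPrimes (I := T) fun P hP =>
    have ⟨s, hs, h, hh⟩ := exists_comp_eq_smul_id_of_mem_minimalPrimes hπ hP
    ⟨s, ⟨h, hh⟩, hs⟩
  refine ⟨d, hd, n, fun i => LinearMap.proj i ∘ₗ h, fun i => π (Pi.single i 1), fun x => ?_⟩
  have h1 : π (h x) = d • x := LinearMap.congr_fun hh x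
  rw [← h1]
  conv_lhs => rw [pi_eq_sum_univ' (h x)]
  simp [map_sum]

/-- If `R` is F-finite and reduced, there is `d ∈ R°` such that `R_d` is F-split and `F_* R_d` is
projective; both properties are expressed by `p⁻¹`-linear maps of `R`. -/
theorem IsFFinite.exists_dual_basis [IsNoetherianRing R] [IsReduced R] [Fact p.Prime] [CharP R p]
    (hF : IsFFinite R p) :
    ∃ d ∈ ringCirc R, (∃ φ : R →+ R, IsCartierMap p 1 φ ∧ φ 1 = d) ∧
      ∃ (n : ℕ) (φ : Fin n → R →+ R) (u : Fin n → R), (∀ i, IsCartierMap p 1 (φ i)) ∧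
        ∀ x, d ^ p * x = ∑ i, φ i x ^ p * u i := by
  have := hF.finite_frobTwist 1
  obtain ⟨d, hd, n, φ, u, h⟩ := exists_dual_sum_eq_smul (R := R) (FrobTwist R p 1)
  let ψ : Fin n → R →+ R :=
    fun i => (φ i).toAddMonoidHom.comp (toFrobTwist R p 1).toAddMonoidHom
  have hψ : ∀ i, IsCartierMap p 1 (ψ i) := fun i => isCartierMap_of_linearMap (φ i)
  have hsum : ∀ x, d ^ p * x = ∑ i, ψ i x ^ p * (toFrobTwist R p 1).symm (u i) := by
    intro x
    have := congrArg (toFrobTwist R p 1).symm (h (toFrobTwist R p 1 x))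
    simp only [Algebra.smul_def, algebraMap_frobTwist, map_mul, map_sum, map_pow,
      RingEquiv.symm_apply_apply, pow_one] at this
    exact this
  -- If all values at 1 of p⁻¹-linear maps lay in P, the expansion of d^p · 1 would put d in P.
  obtain ⟨d', ⟨φ', hφ', hφd'⟩, hd'⟩ := exists_mem_ringCirc_of_forall_minimalPrimes
      (I := cartierIdeal p 1 (1 : R)) (by
    intro P hP
    by_contra! hle
    have : P.IsPrime := hP.1.1
    refine hd P hP (this.mem_of_pow_mem p ?_)
    rw [← mul_one (d ^ p), hsum]
    refine P.sum_mem fun i _ => P.mul_mem_right _ (P.pow_mem_of_mem ?_ p (Fact.out : p.Prime).pos)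
    exact hle _ ⟨ψ i, hψ i, rfl⟩)
  refine ⟨d' * d, mul_mem hd' hd, ⟨_, hφ'.mulLeft_comp d, ?_⟩, n, _,
    fun i => (toFrobTwist R p 1).symm (u i), fun i => (hψ i).mulLeft_comp d', fun x => ?_⟩
  · simp [hφd', mul_comm]
  · rw [mul_pow, mul_assoc, hsum, Finset.mul_sum]
    refine Finset.sum_congr rfl fun i _ => ?_
    simp only [AddMonoidHom.comp_apply, AddMonoidHom.coe_mulLeft]
    ring

/-! ### Strong F-regularity of R_d and test elements -/

theorem cartierIdeal_comp_le {e e' : ℕ} {φ : R →+ R} (hφ : IsCartierMap p e' φ) (x : R) :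
    cartierIdeal p e (φ x) ≤ cartierIdeal p (e + e') x := by
  rintro _ ⟨ψ, hψ, rfl⟩
  exact ⟨_, hψ.comp hφ, rfl⟩

/-- For x = ψ(c), φ(x^(p-1) · x) = φ(x^p) = xφ(1) = dx. Raising the level thus costs one factor d.
-/
theorem mul_mem_cartierIdeal_succ {d : R} {φ : R →+ R} (hφ : IsCartierMap p 1 φ) (hφd : φ 1 = d)
    (hp : 0 < p) {e : ℕ} {c x : R} (hx : x ∈ cartierIdeal p e c) :
    d * x ∈ cartierIdeal p (e + 1) c := by
  obtain ⟨ψ, hψ, rfl⟩ := hx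
  refine ⟨_, (hφ.comp_mulLeft ((ψ c) ^ (p - 1))).comp hψ |> (add_comm 1 e ▸ ·), ?_⟩
  simp only [AddMonoidHom.comp_apply, AddMonoidHom.coe_mulLeft]
  rw [← pow_succ, Nat.sub_add_cancel hp]
  have := hφ (ψ c) 1
  rw [pow_one, mul_one, hφd] at this
  rw [this, mul_comm]

theorem pow_mul_mem_cartierIdeal_add {d : R} {φ : R →+ R} (hφ : IsCartierMap p 1 φ)
    (hφd : φ 1 = d) (hp : 0 < p) {e : ℕ} {c x : R} (hx : x ∈ cartierIdeal p e c) (k : ℕ) :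
    d ^ k * x ∈ cartierIdeal p (e + k) c := by
  induction k with
  | zero => simpa using hx
  | succ k ih =>
    rw [pow_succ', mul_assoc]
    exact mul_mem_cartierIdeal_succ hφ hφd hp ih

/-- Iterate the dual basis expansion: each step takes p-th powers, and values at φᵢ(x) are again
values at x one level up. The exponent k depends on e but not on x. -/
theorem exists_pow_mul_mem_cartierIdeal_pow {d : R} {n : ℕ} {φ : Fin n → R →+ R} {u : Fin n → R}
    (hφ : ∀ i, IsCartierMap p 1 (φ i)) (hsum : ∀ x, d ^ p * x = ∑ i, φ i x ^ p * u i) (e : ℕ) :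
    ∃ k : ℕ, ∀ x : R, d ^ k * x ∈ cartierIdeal p e x ^ p ^ e := by
  induction e with
  | zero => exact ⟨0, fun x => by simpa using ⟨_, IsCartierMap.id, rfl⟩⟩
  | succ e ih =>
    obtain ⟨k, hk⟩ := ih
    refine ⟨k * p + p, fun x => ?_⟩
    rw [pow_add d, mul_assoc, hsum, Finset.mul_sum]
    refine Ideal.sum_mem _ fun i _ => ?_
    rw [pow_mul, ← mul_assoc, ← mul_pow, pow_succ p, pow_mul]
    exact Ideal.mul_mem_right _ _ (Ideal.pow_mem_pow
      (Ideal.pow_right_mono (cartierIdeal_comp_le (hφ i) x) _ (hk _)) p)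

/-- `R_d` is strongly F-regular, for `d` as in `IsFFinite.exists_dual_basis`. -/
theorem exists_pow_mem_cartierIdeal [IsNoetherianRing R] [IsReduced R] (hp : 1 < p) {d : R}
    {φ : R →+ R} (hφ : IsCartierMap p 1 φ) (hφd : φ 1 = d)
    {n : ℕ} {ψ : Fin n → R →+ R} {u : Fin n → R}
    (hψ : ∀ i, IsCartierMap p 1 (ψ i)) (hsum : ∀ x, d ^ p * x = ∑ i, ψ i x ^ p * u i)
    {c : R} (hc : c ∈ ringCirc R) : ∃ e m : ℕ, d ^ m ∈ cartierIdeal p e c := by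
  let I : Ideal R :=
    { carrier := {x | ∃ e m : ℕ, d ^ m * x ∈ cartierIdeal p e c}
      zero_mem' := ⟨0, 0, by simp⟩
      add_mem' := by
        rintro x y ⟨e, m, hx⟩ ⟨e', m', hy⟩
        refine ⟨e + e', (m + m') + (e + e'), ?_⟩
        have h1 := pow_mul_mem_cartierIdeal_add hφ hφd hp.le hx e'
        have h2 := pow_mul_mem_cartierIdeal_add hφ hφd hp.le hy e
        rw [add_comm e' e] at h2
        convert add_mem (Ideal.mul_mem_left _ (d ^ (m' + e)) h1)
          (Ideal.mul_mem_left _ (d ^ (m + e')) h2) using 1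
        ring
      smul_mem' := by
        rintro a x ⟨e, m, hx⟩
        exact ⟨e, m, by rw [smul_eq_mul, mul_left_comm]; exact Ideal.mul_mem_left _ _ hx⟩ }
  let A := Localization.Away d
  have : IsNoetherianRing A := IsLocalization.isNoetherianRing (Submonoid.powers d) A inferInstance
  let J : Ideal A := I.map (algebraMap R A)
  -- Each `cartierIdeal p k c` lies in I, so up to a power of d, c lies in I^(p^k) ⊆ I^k. By Krull,
  -- rc = c for some r in J; as c is a nonzerodivisor, r = 1 and J is the unit ideal.
  have hcJ : ∀ k, algebraMap R A c ∈ J ^ k := by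
    intro k
    obtain ⟨l, hl⟩ := exists_pow_mul_mem_cartierIdeal_pow hψ hsum k
    have h1 : d ^ l * c ∈ I ^ k := by
      refine Ideal.pow_le_pow_right (Nat.lt_pow_self hp).le (Ideal.pow_right_mono ?_ _ (hl c))
      exact fun x hx => ⟨k, 0, by simpa using hx⟩
    have h2 := Ideal.mem_map_of_mem (algebraMap R A) h1
    rw [Ideal.map_pow, map_mul] at h2
    have hu : IsUnit (algebraMap R A (d ^ l)) :=
      IsLocalization.map_units (M := Submonoid.powers d) A ⟨d ^ l, l, rfl⟩
    exact (Ideal.unit_mul_mem_iff_mem _ hu).1 h2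
  obtain ⟨r, hr⟩ := (J.mem_iInf_smul_pow_eq_bot_iff (algebraMap R A c)).1 (by
    simpa [Submodule.mem_iInf] using hcJ)
  have hcA : algebraMap R A c ∈ nonZeroDivisors A :=
    IsLocalization.map_nonZeroDivisors_le (Submonoid.powers d) A
      ⟨c, ringCirc_le_nonZeroDivisors hc, rfl⟩
  have hr1 : (r : A) = 1 := by
    have h0 : ((r : A) - 1) * algebraMap R A c = 0 := by
      rw [sub_mul, one_mul, ← smul_eq_mul, hr, sub_self]
    exact sub_eq_zero.1 ((mem_nonZeroDivisors_iff_right.1 hcA) _ h0)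
  have h1J : algebraMap R A 1 ∈ J := by rw [map_one, ← hr1]; exact r.2
  obtain ⟨⟨_, m, rfl⟩, hm⟩ :=
    (IsLocalization.algebraMap_mem_map_algebraMap_iff (Submonoid.powers d) A I 1).1 h1J |>
      fun ⟨m, hm, h⟩ => (⟨⟨m, hm⟩, h⟩ : ∃ m : Submonoid.powers d, (m : R) * 1 ∈ I)
  obtain ⟨e, m', h⟩ := hm
  refine ⟨e, m' + m, ?_⟩
  rw [pow_add]
  simpa using h

/-- The exponent 2 is stable: φ(d^(p-2) · d²) = φ(d^p) = d². The value therefore does not depend on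
e, which keeps the test element independent of c. -/
theorem exists_isCartierMap_apply_one {d : R} {φ : R →+ R} (hp : 1 < p) (hφ : IsCartierMap p 1 φ)
    (hφd : φ 1 = d) (e : ℕ) : ∃ θ : R →+ R, IsCartierMap p e θ ∧ θ 1 = d ^ 2 := by
  induction e with
  | zero => exact ⟨_, IsCartierMap.id.mulLeft_comp (d ^ 2), by simp⟩
  | succ e ih =>
    obtain ⟨θ, hθ, h1⟩ := ih
    refine ⟨_, (hφ.comp_mulLeft (d ^ (p - 2))).comp hθ |> (add_comm 1 e ▸ ·), ?_⟩
    simp only [AddMonoidHom.comp_apply, AddMonoidHom.coe_mulLeft]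
    have := hφ d 1
    rw [pow_one, mul_one, hφd] at this
    rw [h1, ← pow_add, Nat.sub_add_cancel hp, this, sq]

/-- Existence of test elements, in terms of `p⁻ᵉ`-linear maps. -/
theorem IsFFinite.exists_test_element [IsNoetherianRing R] [IsReduced R] [Fact p.Prime]
    [CharP R p] (hF : IsFFinite R p) :
    ∃ D ∈ ringCirc R, ∀ c ∈ ringCirc R, ∀ e₀ : ℕ, ∃ e ≥ e₀, D ∈ cartierIdeal p e c := by
  have hp : 1 < p := (Fact.out : p.Prime).one_lt
  obtain ⟨d, hd, ⟨φ, hφ, hφd⟩, n, ψ, u, hψ, hsum⟩ := hF.exists_dual_basis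
  refine ⟨d ^ 3, pow_mem hd 3, fun c hc e₀ => ?_⟩
  obtain ⟨e, m, χ, hχ, hχc⟩ := exists_pow_mem_cartierIdeal hp hφ hφd hψ hsum hc
  obtain ⟨θ, hθ, hθ1⟩ := exists_isCartierMap_apply_one hp hφ hφd (m + e₀)
  -- Pad d^m = χ(c) to d^(p^(m+e₀)); then θ takes it to d · θ(1) = d³, whatever m was.
  have hle : m ≤ p ^ (m + e₀) := (Nat.le_add_right m e₀).trans (Nat.lt_pow_self hp).le
  refine ⟨m + e₀ + e, by omega, _, (hθ.comp_mulLeft (d ^ (p ^ (m + e₀) - m))).comp hχ, ?_⟩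
  simp only [AddMonoidHom.comp_apply, AddMonoidHom.coe_mulLeft]
  rw [hχc, ← pow_add, Nat.sub_add_cancel hle]
  have := hθ d 1
  rw [mul_one, hθ1] at this
  rw [this, ← pow_succ']

/-! ### Ceilings and powers of ideals -/

theorem pow_mem_ceilPow {r : ℕ} {𝔞 : Fin r → Ideal R} {t : Fin r → ℝ} {e : ℕ} {y : R}
    (hy : y ∈ ceilPow p 𝔞 t e) (e' : ℕ) : y ^ p ^ e' ∈ ceilPow p 𝔞 t (e + e') := by
  have h : ceilPow p 𝔞 t e ^ p ^ e' ≤ ceilPow p 𝔞 t (e + e') := by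
    rw [ceilPow, ceilPow, ← Finset.prod_pow]
    refine Finset.prod_le_prod' fun i _ => ?_
    rw [← pow_mul]
    refine Ideal.pow_le_pow_right (Nat.ceil_le.2 ?_)
    push_cast
    rw [pow_add, ← mul_assoc]
    exact mul_le_mul_of_nonneg_right (Nat.le_ceil _) (by positivity)
  exact h (Ideal.pow_mem_pow hy _)

theorem ceilPow_singleton (𝔞 : Ideal R) (t : ℝ) (e : ℕ) :
    ceilPow p ![𝔞] ![t] e = 𝔞 ^ ⌈t * (p : ℝ) ^ e⌉₊ := by
  simp [ceilPow]

theorem ceilPow_pair (𝔞 𝔟 : Ideal R) (lam mu : ℝ) (e : ℕ) :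
    ceilPow p ![𝔞, 𝔟] ![lam, mu] e =
      𝔞 ^ ⌈lam * (p : ℝ) ^ e⌉₊ * 𝔟 ^ ⌈mu * (p : ℝ) ^ e⌉₊ := by
  simp [ceilPow]

theorem Ideal.add_pow_le_of_forall {𝔞 𝔟 S : Ideal R} {n : ℕ}
    (h : ∀ i j, i + j = n → 𝔞 ^ i * 𝔟 ^ j ≤ S) : (𝔞 + 𝔟) ^ n ≤ S := by
  rw [add_pow, Ideal.sum_eq_sup]
  refine Finset.sup_le fun i hi => ?_
  exact Ideal.mul_le_left.trans (h i (n - i) (by have := Finset.mem_range.1 hi; omega))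

theorem exists_add_eq_and_ceil_eq {t q : ℝ} (ht : 0 ≤ t) (hq : 0 < q) {i j : ℕ}
    (hij : i + j = ⌈t * q⌉₊) :
    ∃ lam mu : ℝ, 0 ≤ lam ∧ 0 ≤ mu ∧ lam + mu = t ∧ ⌈lam * q⌉₊ = i ∧ ⌈mu * q⌉₊ = j := by
  -- In general λ = i/q. When j = 0 this may exceed t, so (t, 0) is used instead.
  rcases Nat.eq_zero_or_pos j with rfl | hj
  · exact ⟨t, 0, ht, le_rfl, add_zero t, by simpa using hij.symm, by simp⟩
  · have hi : (i : ℝ) < t * q := Nat.lt_ceil.1 (by omega)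
    have hdiv : (i : ℝ) / q * q = i := div_mul_cancel₀ _ hq.ne'
    refine ⟨i / q, t - i / q, by positivity, ?_, by ring, by rw [hdiv, Nat.ceil_natCast], ?_⟩
    · rw [sub_nonneg, div_le_iff₀ hq]
      exact hi.le
    · rw [sub_mul, hdiv, Nat.ceil_sub_natCast, ← hij]
      omega

/-! ### Comparison of the ideals `tauTilde` -/

section

variable [Fact p.Prime] [CharP R p]

theorem tightClosure_le_of_ceilPow_le {r s : ℕ} {𝔞 : Fin r → Ideal R} {t : Fin r → ℝ}
    {𝔟 : Fin s → Ideal R} {v : Fin s → ℝ} (h : ∀ e, ceilPow p 𝔟 v e ≤ ceilPow p 𝔞 t e)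
    {M : Type u} [AddCommGroup M] [Module R M] (N : Submodule R M) :
    tightClosure p 𝔞 t N ≤ tightClosure p 𝔟 v N := by
  rintro z ⟨c, hc, e₀, hz⟩
  exact ⟨c, hc, e₀, fun e he x hx => hz e he x (h e hx)⟩

theorem tauTilde_le_of_ceilPow_le {r s : ℕ} {𝔞 : Fin r → Ideal R} {t : Fin r → ℝ}
    {𝔟 : Fin s → Ideal R} {v : Fin s → ℝ} (h : ∀ e, ceilPow p 𝔟 v e ≤ ceilPow p 𝔞 t e) :
    tauTilde p 𝔟 v ≤ tauTilde p 𝔞 t :=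
  Submodule.annihilator_mono (tightClosure_le_of_ceilPow_le h _)

/-- For a test element `D`, the values of all `p⁻ᵉ`-linear maps on
`D 𝔞₁ ^ ⌈t₁ q⌉ ⋯ 𝔞ᵣ ^ ⌈tᵣ q⌉` lie in `τ̃(𝔞₁ ^ t₁ ⋯ 𝔞ᵣ ^ tᵣ)`. -/
theorem IsCartierMap.apply_mem_tauTilde {D : R}
    (hD : ∀ c ∈ ringCirc R, ∀ e₀ : ℕ, ∃ e ≥ e₀, D ∈ cartierIdeal p e c)
    {e : ℕ} {ψ : R →+ R} (hψ : IsCartierMap p e ψ) {r : ℕ} {𝔞 : Fin r → Ideal R}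
    {t : Fin r → ℝ} {y : R} (hy : y ∈ ceilPow p 𝔞 t e) : ψ (D * y) ∈ tauTilde p 𝔞 t := by
  rw [tauTilde, Submodule.mem_annihilator]
  intro z hz
  obtain ⟨c, hc, e₀, h⟩ := mem_tightClosure_bot.1 hz
  obtain ⟨e', he', θ, hθ, rfl⟩ := hD c hc e₀
  -- With D = θ(c) and q' = p^e', ψ(Dy) = ψ(θ(c y^q')), and c y^q' ⊗ z vanishes at level e + e' ≥
  -- e₀.
  have := (hψ.comp hθ).smul_eq_zero (h (e + e') (by omega) _ (pow_mem_ceilPow hy e'))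
  rwa [AddMonoidHom.comp_apply, mul_comm c, hθ, mul_comm] at this

theorem tauTilde_add_le [IsNoetherianRing R] [IsReduced R] (hF : IsFFinite R p) (𝔞 𝔟 : Ideal R)
    {t : ℝ} (ht : 0 ≤ t) {S : Ideal R}
    (hS : ∀ lam mu : ℝ, 0 ≤ lam → 0 ≤ mu → lam + mu = t →
      tauTilde p ![𝔞, 𝔟] ![lam, mu] ≤ S) :
    tauTilde p ![𝔞 + 𝔟] ![t] ≤ S := by
  intro x hx
  by_contra hxS
  obtain ⟨z, hSz, hxz⟩ := exists_residueHull_smul_ne_zero hxS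
  refine hxz (Submodule.mem_annihilator.1 hx z ?_)
  obtain ⟨D, hDR, hD⟩ := hF.exists_test_element
  refine mem_tightClosure_bot.2 ⟨D, hDR, 0, fun e _ y hy => ?_⟩
  refine tmul_residueHull_eq_zero hF fun ψ hψ => hSz _ ?_
  -- Since T is an ideal, membership can be checked on each `𝔞 ^ i * 𝔟 ^ j` separately.
  let T : Ideal R :=
    { carrier := {y | ∀ ψ : R →+ R, IsCartierMap p e ψ → ψ (D * y) ∈ S}
      zero_mem' := fun ψ _ => by simp
      add_mem' := fun ha hb ψ hψ => by
        rw [mul_add, map_add]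
        exact add_mem (ha ψ hψ) (hb ψ hψ)
      smul_mem' := fun a b hb ψ hψ => by
        have := hb _ (hψ.comp_mulLeft a)
        rwa [AddMonoidHom.comp_apply, AddMonoidHom.coe_mulLeft, mul_left_comm] at this }
  suffices h : ceilPow p ![𝔞 + 𝔟] ![t] e ≤ T from h hy ψ hψ
  rw [ceilPow_singleton]
  refine Ideal.add_pow_le_of_forall fun i j hij => ?_
  obtain ⟨lam, mu, hlam, hmu, hadd, rfl, rfl⟩ := exists_add_eq_and_ceil_eq ht
    (pow_pos (Nat.cast_pos.2 (Fact.out : p.Prime).pos) e) hij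
  rw [← ceilPow_pair]
  exact fun y hy ψ hψ => hS lam mu hlam hmu hadd (hψ.apply_mem_tauTilde hD hy)

end

end

theorem theorem3p1 {R : Type u} [CommRing R] [IsNoetherianRing R] [IsReduced R]
    (p : ℕ) [Fact p.Prime] [CharP R p] (hF : IsFFinite R p)
    (𝔞 𝔟 : Ideal R) (h𝔞 : ∃ c ∈ 𝔞, c ∈ ringCirc R) (h𝔟 : ∃ c ∈ 𝔟, c ∈ ringCirc R)
    (t : ℝ) (ht : 0 < t) :
    tauTilde p ![𝔞 + 𝔟] ![t] =
      ⨆ (lam : ℝ) (mu : ℝ) (_ : 0 ≤ lam) (_ : 0 ≤ mu) (_ : lam + mu = t),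
        tauTilde p ![𝔞, 𝔟] ![lam, mu] := by
  refine le_antisymm (tauTilde_add_le hF 𝔞 𝔟 ht.le fun lam mu hlam hmu hadd => ?_) ?_
  · exact le_iSup_of_le lam (le_iSup_of_le mu (le_iSup_of_le hlam (le_iSup_of_le hmu
      (le_iSup_of_le hadd le_rfl))))
  · refine iSup_le fun lam => iSup_le fun mu => iSup_le fun _ => iSup_le fun _ =>
      iSup_le fun hadd => tauTilde_le_of_ceilPow_le fun e => ?_
    rw [ceilPow_singleton, ceilPow_pair]
    refine (Ideal.mul_mono (Ideal.pow_right_mono (le_sup_left : 𝔞 ≤ 𝔞 ⊔ 𝔟) _)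
      (Ideal.pow_right_mono (le_sup_right : 𝔟 ≤ 𝔞 ⊔ 𝔟) _)).trans ?_
    rw [Submodule.add_eq_sup, ← pow_add]
    refine Ideal.pow_le_pow_right ?_
    rw [← hadd, add_mul]
    exact Nat.ceil_add_le _ _
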